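/- Let $I$ be a finite index set and equip $\mathbb{R}^I$ with the maximum norm $\|\cdot\|$. On a probability space with a filtration $(F_t)_{t\ge 0}$ (the history), let $x_t$, $\alpha_t$, $e_t$ ($t=0,1,2,\dots$) be random vectors in $\mathbb{R}^I$ satisfying $$x_{t+1}(i)=(1-\alpha_t(i))\,x_t(i)+\alpha_t(i)\big((H_tx_t)(i)+e_t(i)\big)\qquad\text{for all } t\ge 0,\ i\in I,$$ where $H_t:\mathbb{R}^I\to\mathbb{R}^I$ are (possibly random) mappings. Assume that $x_t$, $\alpha_t$ and $H_t$ are determined by the history at time $t$, that is, $x_t$, $\alpha_t$ and, for each $z\in\mathbb{R}^I$, $H_tz$ are $F_t$-measurable, and that $e_t$ is $F_{t+1}$-measurable. Assume further: 1. There is a constant $\gamma\in[0,1)$ such that, almost surely, $\|H_ty-H_tz\|\le\gamma\|y-z\|$ for all $t$ and all $y,z\in\mathbb{R}^I$; and, almost surely, $\lim_{t\to\infty}H_tz=H^\ast z$ for every $z\in\mathbb{R}^I$, where $H^\ast:\mathbb{R}^I\to\mathbb{R}^I$ is a (possibly random) mapping. 2. Almost surely, for all $t,i$: $\alpha_t(i)\ge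 0$, $\sum_{t=0}^\infty\alpha_t(i)=\infty$ and $\sum_{t=0}^\infty\alpha_t(i)^2<\infty$. 3. For all $t,i$: $e_t(i)$ is integrable, $\mathbb{E}[e_t(i)\mid F_t]=0$ almost surely, and $\mathbb{E}[e_t(i)^2\mid F_t]\le K(1+\|x_t\|^2)$ almost surely, where $K$ is a constant that does not depend on $t$ or $i$. Then, almost surely, $H^\ast$ has a unique fixed point $x^\ast$, and $x_t\to x^\ast$ as $t\to\infty$. -/

import Mathlib

open MeasureTheory ProbabilityTheory Filter Topology
open scoped NNReal ENNReal

/-! Stochastic approximation, with the noise scaled by the running maximum `G t` of the iterates.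
The variance bound grows with `‖x t‖`, so the noise sums cannot be controlled before boundedness is
known; but `e t / G t` has bounded conditional variance, so the martingale with increments `α t * (e
t / G t)` converges almost surely (`ae_tendsto_sum_of_summable_variance`). The rest is
deterministic, path by path.

After a late time `s` the tails of that series are at most `ε`, and the averaged noise is at most `4
* ε * G` (`abs_expAverage_le`). Subtracting it from `x` leaves a plain average of the values `h t =
H t (x t)`. Since `γ < 1`, the contraction leaves room for this error, so `G` is bounded
(`bounded_of_stochastic_iteration`). Then an eventual bound `M` on the distance to the fixed point
improves to `γ * M + δ`, and iterating this forces convergence (`tendsto_of_stochastic_iteration`).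
-/

/-! ### Deterministic averaging recursions. -/

/-- The exponentially averaged process `w (n + 1) = (1 - a n) * w n + a n * f n` started at `0`. -/
noncomputable def expAverage (a f : ℕ → ℝ) : ℕ → ℝ
  | 0 => 0
  | n + 1 => (1 - a n) * expAverage a f n + a n * f n

lemma abs_convexComb_le {a u v b : ℝ} (h0 : 0 ≤ a) (h1 : a ≤ 1) (hu : |u| ≤ b) (hv : |v| ≤ b) :
    |(1 - a) * u + a * v| ≤ b := by
  rw [abs_le] at *
  constructor <;> nlinarith

lemma abs_le_of_averaging {a f u : ℕ → ℝ} {b : ℝ} {n : ℕ} (h0 : ∀ t, 0 ≤ a t) (h1 : ∀ t, a t ≤ 1)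
    (hu : ∀ t, u (t + 1) = (1 - a t) * u t + a t * f t) (hu0 : |u 0| ≤ b)
    (hf : ∀ t < n, |f t| ≤ b) : |u n| ≤ b := by
  induction n with
  | zero => exact hu0
  | succ n ih =>
    rw [hu]
    exact abs_convexComb_le (h0 n) (h1 n) (ih fun t ht => hf t (by omega)) (hf n (by omega))

/-- Summation by parts for a monotone weight. -/
lemma abs_sum_monotone_mul_le {G d : ℕ → ℝ} {ε : ℝ} (hG : Monotone G) (hG0 : ∀ t, 0 ≤ G t)
    (hd : ∀ n, |∑ t ∈ Finset.range n, d t| ≤ ε) (n : ℕ) :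
    |∑ t ∈ Finset.range (n + 1), G t * d t| ≤ 2 * ε * G n := by
  have key : ∀ n, |∑ t ∈ Finset.range (n + 1), G t * d t
      - G n * ∑ t ∈ Finset.range (n + 1), d t| ≤ ε * (G n - G 0) := by
    intro n
    induction n with
    | zero => simp
    | succ n ih =>
      rw [Finset.sum_range_succ, Finset.sum_range_succ (fun t => d t) (n + 1)]
      have h1 := hd (n + 1)
      have h2 : 0 ≤ G (n + 1) - G n := sub_nonneg.2 (hG n.le_succ)
      rw [abs_le] at *
      constructor <;> nlinarith
  have h1 := key n
  have h2 := hd (n + 1)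
  have h3 := hG0 n
  have h4 := hG0 0
  have h5 : 0 ≤ ε := (abs_nonneg _).trans h2
  have h6 : |G n * ∑ t ∈ Finset.range (n + 1), d t| ≤ G n * ε := by
    rw [abs_mul, abs_of_nonneg h3]
    gcongr
  have h7 := mul_nonneg h5 h4
  rw [abs_le] at *
  constructor <;> nlinarith

/-- With `R` the weighted partial sums, the average minus `R` is itself an average of `-R`; so
summation by parts for `R` bounds both pieces. The bound at `n + 1` involves only `G n`, which lets
the boundedness induction close. -/
lemma abs_expAverage_le {a G z : ℕ → ℝ} {ε : ℝ} (h0 : ∀ t, 0 ≤ a t) (h1 : ∀ t, a t ≤ 1)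
    (hG : Monotone G) (hG0 : ∀ t, 0 ≤ G t)
    (hz : ∀ n, |∑ t ∈ Finset.range n, a t * z t| ≤ ε) (n : ℕ) :
    |expAverage a (fun t => G t * z t) (n + 1)| ≤ 4 * ε * G n := by
  set R : ℕ → ℝ := fun n => ∑ t ∈ Finset.range n, G t * (a t * z t) with hR
  have hε : 0 ≤ ε := (abs_nonneg _).trans (hz 0)
  have hRb : ∀ n, |R (n + 1)| ≤ 2 * ε * G n := abs_sum_monotone_mul_le hG hG0 hz
  have hb : 0 ≤ 2 * ε * G n := mul_nonneg (by positivity) (hG0 n)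
  have hV : |expAverage a (fun t => G t * z t) (n + 1) - R (n + 1)| ≤ 2 * ε * G n := by
    refine abs_le_of_averaging (u := fun n => expAverage a (fun t => G t * z t) n - R n)
      (f := fun n => - R n) h0 h1 (fun t => ?_) ?_ (fun t ht => ?_)
    · simp only [expAverage, hR, Finset.sum_range_succ]
      ring
    · simpa [expAverage, hR] using hb
    · rw [abs_neg]
      cases t with
      | zero => simpa [hR] using hb
      | succ t =>
        exact (hRb t).trans (mul_le_mul_of_nonneg_left (hG (by omega)) (by positivity))
  have := hRb n
  rw [abs_le] at *
  constructor <;> linarith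

lemma sub_expAverage_succ {a f g u : ℕ → ℝ}
    (hu : ∀ t, u (t + 1) = (1 - a t) * u t + a t * (f t + g t)) (t : ℕ) :
    u (t + 1) - expAverage a g (t + 1)
      = (1 - a t) * (u t - expAverage a g t) + a t * f t := by
  simp only [expAverage, hu]
  ring

/-- Averaging with step sizes of infinite sum forgets the initial value. -/
lemma eventually_abs_le_of_averaging {a f u : ℕ → ℝ} {c δ : ℝ} (h0 : ∀ t, 0 ≤ a t)
    (h1 : ∀ t, a t ≤ 1) (hsum : Tendsto (fun n => ∑ t ∈ Finset.range n, a t) atTop atTop)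
    (hu : ∀ t, u (t + 1) = (1 - a t) * u t + a t * f t) (hf : ∀ t, |f t| ≤ c) (hδ : 0 < δ) :
    ∀ᶠ n in atTop, |u n| ≤ c + δ := by
  -- The positive part keeps the right side nonnegative, so that `1 - a n` may be replaced by `exp
  -- (-a n)`.
  have key : ∀ n, |u n| - c ≤ Real.exp (-∑ t ∈ Finset.range n, a t) * max (|u 0| - c) 0 := by
    intro n
    induction n with
    | zero => simp
    | succ n ih =>
      have e1 : 1 - a n ≤ Real.exp (-a n) := by linarith [Real.add_one_le_exp (-a n)]
      have e2 : |u (n + 1)| ≤ (1 - a n) * |u n| + a n * c := by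
        rw [hu]
        refine (abs_add_le _ _).trans ?_
        rw [abs_mul, abs_mul, abs_of_nonneg (h0 n), abs_of_nonneg (sub_nonneg.2 (h1 n))]
        gcongr
        · exact h0 n
        · exact hf n
      rw [Finset.sum_range_succ, neg_add, Real.exp_add]
      set E := Real.exp (-∑ t ∈ Finset.range n, a t) * max (|u 0| - c) 0 with hE
      have hE0 : 0 ≤ E := by positivity
      calc |u (n + 1)| - c ≤ (1 - a n) * (|u n| - c) := by linarith
        _ ≤ (1 - a n) * E := mul_le_mul_of_nonneg_left ih (sub_nonneg.2 (h1 n))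
        _ ≤ Real.exp (-a n) * E := mul_le_mul_of_nonneg_right e1 hE0
        _ = _ := by rw [hE]; ring
  have hlim : Tendsto (fun n => Real.exp (-∑ t ∈ Finset.range n, a t) * max (|u 0| - c) 0)
      atTop (𝓝 0) := by
    simpa using (Real.tendsto_exp_neg_atTop_nhds_zero.comp hsum).mul_const (max (|u 0| - c) 0)
  filter_upwards [hlim.eventually (gt_mem_nhds hδ)] with n hn
  linarith [key n]

/-- A nonnegative quantity whose eventual bounds contract tends to zero. -/
lemma tendsto_zero_of_eventually_le_contract {r : ℕ → ℝ} {γ B : ℝ} (hr : ∀ t, 0 ≤ r t)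
    (hγ0 : 0 ≤ γ) (hγ1 : γ < 1) (hB : ∀ t, r t ≤ B)
    (hstep : ∀ M δ : ℝ, 0 < δ → (∀ᶠ t in atTop, r t ≤ M) → ∀ᶠ t in atTop, r t ≤ γ * M + δ) :
    Tendsto r atTop (𝓝 0) := by
  have h1 : 0 < 1 - γ := by linarith
  have hk : ∀ δ > 0, ∀ k : ℕ, ∀ᶠ t in atTop, r t ≤ γ ^ k * B + δ / (1 - γ) := by
    intro δ hδ k
    induction k with
    | zero =>
      refine Eventually.of_forall fun t => ?_
      have : 0 ≤ δ / (1 - γ) := by positivity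
      simpa using (hB t).trans (by linarith)
    | succ k ih =>
      filter_upwards [hstep _ δ hδ ih] with t ht
      refine ht.trans (le_of_eq ?_)
      field_simp
      ring
  rw [Metric.tendsto_nhds]
  intro η hη
  have hpow : Tendsto (fun k : ℕ => γ ^ k * B) atTop (𝓝 0) := by
    simpa using (tendsto_pow_atTop_nhds_zero_of_lt_one hγ0 hγ1).mul_const B
  obtain ⟨k, hk'⟩ := (hpow.eventually (gt_mem_nhds (half_pos hη))).exists
  filter_upwards [hk (η / 4 * (1 - γ)) (by positivity) k] with t ht
  rw [Real.dist_eq, sub_zero, abs_of_nonneg (hr t)]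
  rw [mul_div_assoc, div_self h1.ne', mul_one] at ht
  linarith

lemma eventually_abs_tail_sum_le {d : ℕ → ℝ} {c ε : ℝ} (hε : 0 < ε)
    (hd : Tendsto (fun n => ∑ t ∈ Finset.range n, d t) atTop (𝓝 c)) :
    ∀ᶠ s in atTop, ∀ n, |∑ t ∈ Finset.range n, d (s + t)| ≤ ε := by
  obtain ⟨N, hN⟩ := Metric.cauchySeq_iff.1 hd.cauchySeq ε hε
  filter_upwards [eventually_ge_atTop N] with s hs n
  have := hN (s + n) (by omega) s hs
  rw [Real.dist_eq, Finset.sum_range_add, add_sub_cancel_left] at this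
  exact this.le

lemma eventually_forall_ge_le_one {a : ℕ → ℝ} (ha : Summable fun t => a t ^ 2) :
    ∀ᶠ s in atTop, ∀ t, a (s + t) ≤ 1 := by
  obtain ⟨N, hN⟩ := eventually_atTop.1
    (ha.tendsto_atTop_zero.eventually (gt_mem_nhds (zero_lt_one (α := ℝ))))
  filter_upwards [eventually_ge_atTop N] with s hs t
  nlinarith [hN (s + t) (by omega)]

/-! ### Pathwise boundedness and convergence. -/

section Pathwise

variable {ι : Type*} [Fintype ι] {x a z h : ℕ → ι → ℝ} {G : ℕ → ℝ} {γ : ℝ}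

lemma eventually_forall_tail (ha2 : ∀ i, Summable fun t => a t i ^ 2)
    (hz : ∀ i, ∃ c, Tendsto (fun n => ∑ t ∈ Finset.range n, a t i * z t i) atTop (𝓝 c))
    {ε : ℝ} (hε : 0 < ε) :
    ∀ᶠ s in atTop, ∀ i, (∀ t, a (s + t) i ≤ 1) ∧
      ∀ n, |∑ t ∈ Finset.range n, a (s + t) i * z (s + t) i| ≤ ε := by
  rw [eventually_all]
  intro i
  obtain ⟨c, hc⟩ := hz i
  exact (eventually_forall_ge_le_one (ha2 i)).and (eventually_abs_tail_sum_le hε hc)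

theorem bounded_of_stochastic_iteration (hγ1 : γ < 1) (hγ0 : 0 ≤ γ) {C : ℝ}
    (ha0 : ∀ t i, 0 ≤ a t i) (ha2 : ∀ i, Summable fun t => a t i ^ 2)
    (hz : ∀ i, ∃ c, Tendsto (fun n => ∑ t ∈ Finset.range n, a t i * z t i) atTop (𝓝 c))
    (hxG : ∀ t, ‖x t‖ ≤ G t) (hG : ∀ t, G (t + 1) = max (G t) ‖x (t + 1)‖)
    (hrec : ∀ t i, x (t + 1) i = (1 - a t i) * x t i + a t i * (h t i + G t * z t i))
    (hh : ∀ t i, |h t i| ≤ γ * ‖x t‖ + C) : ∃ B, ∀ t, G t ≤ B := by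
  have hG0 : ∀ t, 0 ≤ G t := fun t => (norm_nonneg _).trans (hxG t)
  have hGm : Monotone G := monotone_nat_of_le_succ fun t => by rw [hG]; exact le_max_left _ _
  -- Half of the contraction gap `1 - γ` is given to the noise term `4 * ε`.
  set ε := (1 - γ) / 8 with hε
  have hε0 : 0 < ε := by rw [hε]; linarith
  have hp : 0 < 1 - γ - 4 * ε := by rw [hε]; linarith
  have hq : 0 < 1 - 4 * ε := by linarith
  obtain ⟨s, hs⟩ := (eventually_forall_tail ha2 hz hε0).exists
  -- Chosen so that `G s` and `γ * B + C` are both at most `B * (1 - 4 * ε)`; the averaged noise, at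
  -- most `4 * ε * B`, fills the remainder.
  set B := max (G s / (1 - 4 * ε)) (C / (1 - γ - 4 * ε)) with hB
  have hB1 : G s ≤ B * (1 - 4 * ε) := (div_le_iff₀ hq).1 (le_max_left _ _)
  have hB2 : C ≤ B * (1 - γ - 4 * ε) := (div_le_iff₀ hp).1 (le_max_right _ _)
  have hB0 : 0 ≤ B := (div_nonneg (hG0 s) hq.le).trans (le_max_left _ _)
  have hsB : G s ≤ B := by nlinarith
  have hbd : ∀ n, G (s + n) ≤ B := by
    intro n
    induction n with
    | zero => exact hsB
    | succ n ih =>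
      rw [← add_assoc, hG]
      refine max_le ih ((pi_norm_le_iff_of_nonneg hB0).2 fun i => ?_)
      rw [Real.norm_eq_abs]
      have hW := abs_expAverage_le (a := fun t => a (s + t) i) (G := fun t => G (s + t))
        (fun t => ha0 _ i) (hs i).1 (fun m n hmn => hGm (by omega)) (fun t => hG0 _) (hs i).2 n
      have hY := abs_le_of_averaging (n := n + 1) (b := B * (1 - 4 * ε))
        (f := fun t => h (s + t) i)
        (u := fun t => x (s + t) i - expAverage (fun t => a (s + t) i)
          (fun t => G (s + t) * z (s + t) i) t)
        (fun t => ha0 (s + t) i) (hs i).1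
        (sub_expAverage_succ (a := fun t => a (s + t) i) (u := fun t => x (s + t) i)
          (f := fun t => h (s + t) i) (g := fun t => G (s + t) * z (s + t) i)
          fun t => hrec (s + t) i)
        (by
          have := (norm_le_pi_norm (x s) i).trans (hxG s)
          simpa [expAverage] using this.trans hB1)
        (fun t ht => by
          have h1 := hh (s + t) i
          have h2 : ‖x (s + t)‖ ≤ B := (hxG _).trans ((hGm (by omega)).trans ih)
          nlinarith)
      have h3 : 4 * ε * G (s + n) ≤ 4 * ε * B := by gcongr
      simp only [← add_assoc] at hY
      rw [abs_le] at *
      constructor <;> linarith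
  refine ⟨B, fun t => (hGm (Nat.le_add_left t s)).trans (hbd t)⟩

theorem tendsto_of_stochastic_iteration (hγ1 : γ < 1) (hγ0 : 0 ≤ γ) {B : ℝ} {p : ι → ℝ}
    {r : ℕ → ℝ} (ha0 : ∀ t i, 0 ≤ a t i) (ha2 : ∀ i, Summable fun t => a t i ^ 2)
    (ha1 : ∀ i, Tendsto (fun n => ∑ t ∈ Finset.range n, a t i) atTop atTop)
    (hz : ∀ i, ∃ c, Tendsto (fun n => ∑ t ∈ Finset.range n, a t i * z t i) atTop (𝓝 c))
    (hxG : ∀ t, ‖x t‖ ≤ G t) (hGm : Monotone G) (hGB : ∀ t, G t ≤ B)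
    (hrec : ∀ t i, x (t + 1) i = (1 - a t i) * x t i + a t i * (h t i + G t * z t i))
    (hh : ∀ t i, |h t i - p i| ≤ γ * ‖x t - p‖ + r t) (hr : Tendsto r atTop (𝓝 0)) :
    Tendsto x atTop (𝓝 p) := by
  have hG0 : ∀ t, 0 ≤ G t := fun t => (norm_nonneg _).trans (hxG t)
  have hB0 : 0 ≤ B := (hG0 0).trans (hGB 0)
  rw [tendsto_iff_norm_sub_tendsto_zero]
  refine tendsto_zero_of_eventually_le_contract (B := B + ‖p‖) (fun t => norm_nonneg _) hγ0 hγ1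
    (fun t => (norm_sub_le _ _).trans (by linarith [hxG t, hGB t])) fun M δ hδ hM => ?_
  have hM0 : 0 ≤ M := by
    obtain ⟨t, ht⟩ := hM.exists
    exact (norm_nonneg _).trans ht
  -- One third of `δ` each for the noise, for `r` and for the forgotten initial value; `B + 1`
  -- avoids division by zero.
  set ε := δ / 3 / (4 * (B + 1)) with hε
  have hε0 : 0 < ε := by positivity
  have hεB : 4 * ε * B ≤ δ / 3 := by
    have : 4 * ε * (B + 1) = δ / 3 := by rw [hε]; field_simp
    nlinarith
  obtain ⟨s, hs, hMr⟩ := ((eventually_forall_tail ha2 hz hε0).and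
    (eventually_forall_ge_atTop.2
      (hM.and (hr.eventually (gt_mem_nhds (show 0 < δ / 3 by positivity)))))).exists
  have hcomp : ∀ i, ∀ᶠ n in atTop, |x (s + n) i - p i| ≤ γ * M + δ := by
    intro i
    have hW := abs_expAverage_le (a := fun t => a (s + t) i) (G := fun t => G (s + t))
      (fun t => ha0 _ i) (hs i).1 (fun m n hmn => hGm (by omega)) (fun t => hG0 _) (hs i).2
    have hsum : Tendsto (fun n => ∑ t ∈ Finset.range n, a (s + t) i) atTop atTop := by
      have h1 := (ha1 i).comp (tendsto_add_atTop_nat s)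
      have h2 := tendsto_atTop_add_const_right atTop (-∑ t ∈ Finset.range s, a t i) h1
      refine h2.congr fun n => ?_
      simp only [Function.comp, add_comm n s, Finset.sum_range_add]
      ring
    have hY := eventually_abs_le_of_averaging (c := γ * M + δ / 3) (δ := δ / 3)
      (f := fun t => h (s + t) i - p i)
      (u := fun t => x (s + t) i - p i - expAverage (fun t => a (s + t) i)
        (fun t => G (s + t) * z (s + t) i) t)
      (fun t => ha0 (s + t) i) (hs i).1 hsum
      (sub_expAverage_succ (a := fun t => a (s + t) i) (u := fun t => x (s + t) i - p i)
        (f := fun t => h (s + t) i - p i) (g := fun t => G (s + t) * z (s + t) i)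
        fun t => by
          rw [← add_assoc, hrec (s + t) i]
          ring)
      (fun t => by
        have h1 := hh (s + t) i
        obtain ⟨h2, h3⟩ := hMr (s + t) (by omega)
        have h4 := mul_le_mul_of_nonneg_left h2 hγ0
        linarith) (by positivity)
    filter_upwards [hY, eventually_ge_atTop 1] with n hn hn1
    obtain ⟨m, rfl⟩ : ∃ m, n = m + 1 := ⟨n - 1, by omega⟩
    have h1 := hW m
    have h2 : 4 * ε * G (s + m) ≤ δ / 3 :=
      (mul_le_mul_of_nonneg_left (hGB _) (by positivity)).trans hεB
    rw [abs_le] at *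
    constructor <;> linarith
  have hev : ∀ᶠ n in atTop, ‖x (n + s) - p‖ ≤ γ * M + δ := by
    filter_upwards [eventually_all.2 hcomp] with n hn
    refine (pi_norm_le_iff_of_nonneg (by positivity)).2 fun i => ?_
    rw [add_comm n s]
    exact hn i
  rwa [← map_add_atTop_eq_nat s, eventually_map]

end Pathwise
-- Almost sure convergence of the noise series.
section Noise

variable {Ω : Type*} {m m0 : MeasurableSpace Ω} {μ : Measure Ω}

/-- The measures with densities `f` and `condLExp m μ f` agree on `m`, hence integrate `g` equally.
Working in `ℝ≥0∞` requires no prior integrability of the squared noise. -/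
lemma lintegral_mul_condLExp (hm : m ≤ m0) [IsFiniteMeasure μ] {f g : Ω → ℝ≥0∞}
    (hf : Measurable f) (hg : Measurable[m] g) :
    ∫⁻ ω, condLExp m μ f ω * g ω ∂μ = ∫⁻ ω, f ω * g ω ∂μ := by
  have hg' : Measurable g := hg.mono hm le_rfl
  have htrim : (μ.withDensity (condLExp m μ f)).trim hm = (μ.withDensity f).trim hm := by
    refine @Measure.ext _ m _ _ fun s hs => ?_
    rw [trim_measurableSet_eq hm hs, trim_measurableSet_eq hm hs, withDensity_apply _ (hm s hs),
      withDensity_apply _ (hm s hs), setLIntegral_condLExp hm μ f hs]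
  have h1 := lintegral_withDensity_eq_lintegral_mul μ (measurable_condLExp' m μ f) hg'
  have h2 := lintegral_withDensity_eq_lintegral_mul μ hf hg'
  simp only [Pi.mul_apply] at h1 h2
  rw [← h1, ← h2, ← lintegral_trim hm hg, ← lintegral_trim hm hg, htrim]

/-- Second moment of a predictable multiple of a noise variable. -/
lemma lintegral_sq_mul_le (hm : m ≤ m0) [IsFiniteMeasure μ] {a e v : Ω → ℝ}
    (ha : Measurable[m] a) (he : Measurable e)
    (hev : ∀ᵐ ω ∂μ, condLExp m μ (fun ω' => ENNReal.ofReal (e ω' ^ 2)) ω ≤ ENNReal.ofReal (v ω)) :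
    ∫⁻ ω, ENNReal.ofReal ((a ω * e ω) ^ 2) ∂μ ≤ ∫⁻ ω, ENNReal.ofReal (a ω ^ 2 * v ω) ∂μ := by
  calc ∫⁻ ω, ENNReal.ofReal ((a ω * e ω) ^ 2) ∂μ
      = ∫⁻ ω, ENNReal.ofReal (e ω ^ 2) * ENNReal.ofReal (a ω ^ 2) ∂μ := by
        congr with ω
        rw [← ENNReal.ofReal_mul (sq_nonneg _)]
        ring_nf
    _ = ∫⁻ ω, condLExp m μ (fun ω' => ENNReal.ofReal (e ω' ^ 2)) ω
          * ENNReal.ofReal (a ω ^ 2) ∂μ :=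
        (lintegral_mul_condLExp hm (he.pow_const 2).ennreal_ofReal
          (ha.pow_const 2).ennreal_ofReal).symm
    _ ≤ ∫⁻ ω, ENNReal.ofReal (a ω ^ 2 * v ω) ∂μ := by
        refine lintegral_mono_ae ?_
        filter_upwards [hev] with ω hω
        rw [mul_comm, ENNReal.ofReal_mul (sq_nonneg _)]
        gcongr

variable {ℱ : Filtration ℕ m0} {a e v : ℕ → Ω → ℝ}

/-- Orthogonal increments bound the second moment of the partial sums by `N`, so they form an
`L¹`-bounded martingale and Doob's theorem applies. -/
theorem ae_tendsto_sum_of_bounded_variance [IsProbabilityMeasure μ]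
    (ha : ∀ t, Measurable[ℱ t] (a t)) (he : ∀ t, Measurable[ℱ (t + 1)] (e t))
    (hv : ∀ t, Measurable[ℱ t] (v t)) (hv0 : ∀ t ω, 0 ≤ v t ω)
    (hint : ∀ t, Integrable (e t) μ) (hmean : ∀ t, μ[e t | ℱ t] =ᵐ[μ] 0)
    (hvar : ∀ t, ∀ᵐ ω ∂μ, condLExp (ℱ t) μ (fun ω' => ENNReal.ofReal (e t ω' ^ 2)) ω
      ≤ ENNReal.ofReal (v t ω))
    {N : ℝ} (hN : ∀ n ω, ∑ t ∈ Finset.range n, a t ω ^ 2 * v t ω ≤ N) :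
    ∀ᵐ ω ∂μ, ∃ c, Tendsto (fun n => ∑ t ∈ Finset.range n, a t ω * e t ω) atTop (𝓝 c) := by
  have ham : ∀ t, Measurable (a t) := fun t => (ha t).mono (ℱ.le t) le_rfl
  have hem : ∀ t, Measurable (e t) := fun t => (he t).mono (ℱ.le _) le_rfl
  have hvm : ∀ t, Measurable (v t) := fun t => (hv t).mono (ℱ.le t) le_rfl
  have hw0 : ∀ t ω, 0 ≤ a t ω ^ 2 * v t ω := fun t ω => mul_nonneg (sq_nonneg _) (hv0 t ω)
  have hwN : ∀ t ω, a t ω ^ 2 * v t ω ≤ N := fun t ω =>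
    (Finset.single_le_sum (fun s _ => hw0 s ω) (Finset.self_mem_range_succ t)).trans (hN _ ω)
  have hwint : ∀ t, Integrable (fun ω => a t ω ^ 2 * v t ω) μ := fun t =>
    Integrable.of_bound (((ham t).pow_const 2).mul (hvm t)).aestronglyMeasurable N
      (Eventually.of_forall fun ω => by
        rw [Real.norm_eq_abs, abs_of_nonneg (hw0 t ω)]
        exact hwN t ω)
  set d : ℕ → Ω → ℝ := fun t ω => a t ω * e t ω with hd
  have hdm : ∀ t, Measurable (d t) := fun t => (ham t).mul (hem t)
  have hdle : ∀ t, ∫⁻ ω, ENNReal.ofReal (d t ω ^ 2) ∂μ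
      ≤ ENNReal.ofReal (∫ ω, a t ω ^ 2 * v t ω ∂μ) := fun t => by
    rw [ofReal_integral_eq_lintegral_ofReal (hwint t) (Eventually.of_forall (hw0 t))]
    exact lintegral_sq_mul_le (ℱ.le t) (ha t) (hem t) (hvar t)
  have hdsq : ∀ t, Integrable (fun ω => d t ω ^ 2) μ := fun t => by
    refine ⟨((hdm t).pow_const 2).aestronglyMeasurable, ?_⟩
    rw [hasFiniteIntegral_iff_ofReal (Eventually.of_forall fun ω => sq_nonneg _)]
    exact (hdle t).trans_lt ENNReal.ofReal_lt_top
  have hd2 : ∀ t, MemLp (d t) 2 μ := fun t =>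
    (memLp_two_iff_integrable_sq (hdm t).aestronglyMeasurable).2 (hdsq t)
  have hdsq_le : ∀ t, ∫ ω, d t ω ^ 2 ∂μ ≤ ∫ ω, a t ω ^ 2 * v t ω ∂μ := fun t => by
    have h := hdle t
    rw [← ofReal_integral_eq_lintegral_ofReal (hdsq t)
      (Eventually.of_forall fun ω => sq_nonneg _)] at h
    exact (ENNReal.ofReal_le_ofReal_iff (integral_nonneg (hw0 t))).1 h
  have hdint : ∀ t, Integrable (d t) μ := fun t => (hd2 t).integrable (by norm_num)
  have hdmean : ∀ t, μ[d t | ℱ t] =ᵐ[μ] 0 := fun t => by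
    refine (condExp_mul_of_stronglyMeasurable_left (ha t).stronglyMeasurable
      (hdint t) (hint t)).trans ?_
    filter_upwards [hmean t] with ω hω
    simp [hω]
  set S : ℕ → Ω → ℝ := fun n ω => ∑ t ∈ Finset.range n, d t ω with hS
  have hSsucc : ∀ n, S (n + 1) = S n + d n := fun n => by
    ext ω
    simp [hS, Finset.sum_range_succ]
  have hSm : ∀ n, Measurable[ℱ n] (S n) := fun n => by
    refine Finset.measurable_fun_sum _ fun t ht => ?_
    have : t + 1 ≤ n := Finset.mem_range.1 ht
    exact ((ha t).mono (ℱ.mono (by omega)) le_rfl).mul ((he t).mono (ℱ.mono this) le_rfl)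
  have hS2 : ∀ n, MemLp (S n) 2 μ := fun n => memLp_finsetSum _ fun t _ => hd2 t
  have hSmart : Martingale S ℱ μ := by
    refine martingale_of_condExp_sub_eq_zero_nat (fun n => (hSm n).stronglyMeasurable)
      (fun n => (hS2 n).integrable (by norm_num)) fun n => ?_
    rw [hSsucc, add_sub_cancel_left]
    exact hdmean n
  have hortho : ∀ n, ∫ ω, S n ω * d n ω ∂μ = 0 := fun n => by
    have hprod : Integrable (S n * d n) μ := (hS2 n).integrable_mul (hd2 n)
    have h := condExp_mul_of_stronglyMeasurable_left (hSm n).stronglyMeasurable hprod (hdint n)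
    have h' : ∫ ω, (S n * d n) ω ∂μ = 0 := by
      rw [← integral_condExp (ℱ.le n), integral_congr_ae h]
      refine integral_eq_zero_of_ae ?_
      filter_upwards [hdmean n] with ω hω
      simp [hω]
    exact h'
  have hSsq : ∀ n, ∫ ω, S n ω ^ 2 ∂μ ≤ ∫ ω, ∑ t ∈ Finset.range n, a t ω ^ 2 * v t ω ∂μ := by
    intro n
    induction n with
    | zero => simp [hS]
    | succ n ih =>
      have hprod : Integrable (fun ω => S n ω * d n ω) μ := (hS2 n).integrable_mul (hd2 n)
      have e1 : ∀ ω, S (n + 1) ω ^ 2 = S n ω ^ 2 + 2 * (S n ω * d n ω) + d n ω ^ 2 := fun ω => by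
        rw [hSsucc, Pi.add_apply]
        ring
      have e2 : ∫ ω, S n ω ^ 2 + 2 * (S n ω * d n ω) + d n ω ^ 2 ∂μ
          = ∫ ω, S n ω ^ 2 ∂μ + ∫ ω, d n ω ^ 2 ∂μ := by
        have h1 : Integrable (fun ω => S n ω ^ 2 + 2 * (S n ω * d n ω)) μ :=
          (hS2 n).integrable_sq.add (hprod.const_mul 2)
        rw [integral_add h1 (hdsq n), integral_add (hS2 n).integrable_sq (hprod.const_mul 2),
          integral_const_mul, hortho, mul_zero, add_zero]
      simp_rw [e1, Finset.sum_range_succ]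
      rw [e2, integral_add (integrable_finsetSum _ fun t _ => hwint t) (hwint n)]
      linarith [hdsq_le n]
  have hSN : ∀ n, ∫ ω, S n ω ^ 2 ∂μ ≤ N := fun n => by
    refine (hSsq n).trans ?_
    calc _ ≤ ∫ _, N ∂μ := integral_mono (integrable_finsetSum _ fun t _ => hwint t)
          (integrable_const N) fun ω => hN n ω
      _ = N := by simp
  -- The constant comes from `|s| ≤ (1 + s ^ 2) / 2`.
  refine hSmart.submartingale.exists_ae_tendsto_of_bdd (R := ((1 + N) / 2).toNNReal) fun n => ?_
  have hSint := (hS2 n).integrable (q := 2) (by norm_num)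
  rw [eLpNorm_one_eq_lintegral_enorm, ← ofReal_integral_norm_eq_lintegral_enorm hSint]
  refine ENNReal.ofReal_le_ofReal ?_
  calc ∫ ω, ‖S n ω‖ ∂μ ≤ ∫ ω, (1 + S n ω ^ 2) / 2 ∂μ := by
        refine integral_mono hSint.norm
          (((integrable_const 1).add (hS2 n).integrable_sq).div_const 2) fun ω => ?_
        rw [Real.norm_eq_abs]
        simp only
        nlinarith [sq_nonneg (|S n ω| - 1), sq_abs (S n ω)]
    _ = (1 + ∫ ω, S n ω ^ 2 ∂μ) / 2 := by
        rw [integral_div, integral_add (integrable_const 1) (hS2 n).integrable_sq]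
        simp
    _ ≤ (1 + N) / 2 := by linarith [hSN n]

/-- Either the full sum is still within `N`, or the newest term has been cut off. -/
lemma sum_indicator_le {w : ℕ → ℝ} (hw : ∀ t, 0 ≤ w t) {N : ℝ} (hN : 0 ≤ N) (n : ℕ) :
    ∑ t ∈ Finset.range n, (if ∑ s ∈ Finset.range (t + 1), w s ≤ N then w t else 0) ≤ N := by
  induction n with
  | zero => simpa using hN
  | succ n ih =>
    by_cases h : ∑ s ∈ Finset.range (n + 1), w s ≤ N
    · refine (Finset.sum_le_sum fun t _ => ?_).trans h
      split_ifs
      exacts [le_rfl, hw t]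
    · rwa [Finset.sum_range_succ, if_neg h, add_zero]

/-- A martingale with almost surely summable conditional variances converges almost surely. -/
theorem ae_tendsto_sum_of_summable_variance [IsProbabilityMeasure μ]
    (ha : ∀ t, Measurable[ℱ t] (a t)) (he : ∀ t, Measurable[ℱ (t + 1)] (e t))
    (hv : ∀ t, Measurable[ℱ t] (v t)) (hv0 : ∀ t ω, 0 ≤ v t ω)
    (hint : ∀ t, Integrable (e t) μ) (hmean : ∀ t, μ[e t | ℱ t] =ᵐ[μ] 0)
    (hvar : ∀ t, ∀ᵐ ω ∂μ, condLExp (ℱ t) μ (fun ω' => ENNReal.ofReal (e t ω' ^ 2)) ω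
      ≤ ENNReal.ofReal (v t ω))
    (hsum : ∀ᵐ ω ∂μ, Summable fun t => a t ω ^ 2 * v t ω) :
    ∀ᵐ ω ∂μ, ∃ c, Tendsto (fun n => ∑ t ∈ Finset.range n, a t ω * e t ω) atTop (𝓝 c) := by
  have hw0 : ∀ t ω, 0 ≤ a t ω ^ 2 * v t ω := fun t ω => mul_nonneg (sq_nonneg _) (hv0 t ω)
  -- Localization: the test at time `t` may include the term `t` itself, because that term is `ℱ
  -- t`-measurable; so the truncated variances never exceed `N`.
  set b : ℕ → ℕ → Ω → ℝ := fun N t ω =>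
    if ∑ s ∈ Finset.range (t + 1), a s ω ^ 2 * v s ω ≤ (N : ℝ) then a t ω else 0 with hb
  have hbm : ∀ N t, Measurable[ℱ t] (b N t) := fun N t => by
    suffices h : Measurable[ℱ t] fun ω => ∑ s ∈ Finset.range (t + 1), a s ω ^ 2 * v s ω from
      Measurable.ite (h measurableSet_Iic) (ha t) measurable_const
    refine Finset.measurable_fun_sum _ fun s hs => ?_
    have : s ≤ t := by simpa [Nat.lt_succ_iff] using hs
    exact (((ha s).mono (ℱ.mono this) le_rfl).pow_const 2).mul ((hv s).mono (ℱ.mono this) le_rfl)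
  have hconv : ∀ᵐ ω ∂μ, ∀ N : ℕ,
      ∃ c, Tendsto (fun n => ∑ t ∈ Finset.range n, b N t ω * e t ω) atTop (𝓝 c) := by
    rw [ae_all_iff]
    intro N
    refine ae_tendsto_sum_of_bounded_variance (hbm N) he hv hv0 hint hmean hvar (N := N)
      fun n ω => ?_
    refine le_trans (le_of_eq (Finset.sum_congr rfl fun t _ => ?_))
      (sum_indicator_le (fun t => hw0 t ω) N.cast_nonneg n)
    simp only [hb]
    split_ifs <;> simp
  filter_upwards [hconv, hsum] with ω hω hs
  obtain ⟨N, hN⟩ := exists_nat_ge (∑' t, a t ω ^ 2 * v t ω)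
  -- Once `N` exceeds the total variance along `ω`, nothing is truncated.
  have hbN : ∀ t, b N t ω = a t ω := fun t =>
    if_pos ((hs.sum_le_tsum _ fun s _ => hw0 s ω).trans hN)
  simpa [hbN] using hω N

end Noise
-- Running maximum and conclusion.
/-- The running maximum of a sequence, started at `max 1 (f 0)`. -/
noncomputable def runningMax (f : ℕ → ℝ) : ℕ → ℝ
  | 0 => max 1 (f 0)
  | n + 1 => max (runningMax f n) (f (n + 1))

lemma runningMax_succ (f : ℕ → ℝ) (n : ℕ) :
    runningMax f (n + 1) = max (runningMax f n) (f (n + 1)) := rfl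

lemma le_runningMax (f : ℕ → ℝ) (n : ℕ) : f n ≤ runningMax f n := by
  cases n <;> exact le_max_right _ _

lemma monotone_runningMax (f : ℕ → ℝ) : Monotone (runningMax f) :=
  monotone_nat_of_le_succ fun _ => le_max_left _ _

lemma one_le_runningMax (f : ℕ → ℝ) (n : ℕ) : 1 ≤ runningMax f n :=
  (le_max_left 1 (f 0)).trans (monotone_runningMax f n.zero_le)

lemma measurable_runningMax {Ω : Type*} {m0 : MeasurableSpace Ω} {ℱ : Filtration ℕ m0}
    {f : ℕ → Ω → ℝ} (hf : ∀ t, Measurable[ℱ t] (f t)) (n : ℕ) :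
    Measurable[ℱ n] fun ω => runningMax (fun t => f t ω) n := by
  induction n with
  | zero => exact measurable_const.max (hf 0)
  | succ n ih => exact (ih.mono (ℱ.mono n.le_succ) le_rfl).max (hf (n + 1))

lemma contractingWith_of_tendsto {E : Type*} [MetricSpace E] {γ : ℝ≥0} {F : ℕ → E → E} {F' : E → E}
    (hF : ∀ t, ContractingWith γ (F t)) (hlim : ∀ z, Tendsto (fun t => F t z) atTop (𝓝 (F' z))) :
    ContractingWith γ F' := by
  refine ⟨(hF 0).1, LipschitzWith.of_dist_le_mul fun y z => ?_⟩
  exact le_of_tendsto' ((hlim y).dist (hlim z)) fun t => (hF t).2.dist_le_mul y z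

theorem mainTheorem2
    {ι : Type*} [Fintype ι]
    {Ω : Type*} {m0 : MeasurableSpace Ω} (μ : Measure Ω) [IsProbabilityMeasure μ]
    -- the history of the algorithm
    (ℱ : Filtration ℕ m0)
    -- iterates, step sizes, noise; `ι → ℝ` carries the maximum norm
    (x α e : ℕ → Ω → ι → ℝ)
    -- the (random, time-varying) mappings and their limit
    (H : ℕ → Ω → (ι → ℝ) → (ι → ℝ)) (Hstar : Ω → (ι → ℝ) → (ι → ℝ))
    (γ : ℝ≥0) (K : ℝ)
    -- `x t`, `α t` and `H t` are functions of the history at time `t`;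
    -- the noise `e t` is part of the history at time `t + 1`
    (hx : ∀ t, Measurable[ℱ t] (x t))
    (hα : ∀ t, Measurable[ℱ t] (α t))
    (hH : ∀ t z, Measurable[ℱ t] (fun ω => H t ω z))
    (he : ∀ t, Measurable[ℱ (t + 1)] (e t))
    -- the iteration
    (hrec : ∀ t ω i,
      x (t + 1) ω i = (1 - α t ω i) * x t ω i + α t ω i * (H t ω (x t ω) i + e t ω i))
    -- maximum-norm contractions with common factor `γ < 1`, converging to `Hstar`
    (hcontr : ∀ᵐ ω ∂μ, ∀ t, ContractingWith γ (H t ω))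
    (hlim : ∀ᵐ ω ∂μ, ∀ z, Tendsto (fun t => H t ω z) atTop (𝓝 (Hstar ω z)))
    -- step sizes
    (hα_nonneg : ∀ᵐ ω ∂μ, ∀ t i, 0 ≤ α t ω i)
    (hα_sum : ∀ᵐ ω ∂μ, ∀ i,
      Tendsto (fun n => ∑ t ∈ Finset.range n, α t ω i) atTop atTop)
    (hα_sq : ∀ᵐ ω ∂μ, ∀ i, Summable (fun t => α t ω i ^ 2))
    -- noise: conditional mean zero and conditional second moment bound
    (he_int : ∀ t i, Integrable (fun ω => e t ω i) μ)
    (he_mean : ∀ t i, μ[fun ω => e t ω i | ℱ t] =ᵐ[μ] 0)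
    (he_var : ∀ t i, ∀ᵐ ω ∂μ,
      condLExp (ℱ t) μ (fun ω' => ENNReal.ofReal (e t ω' i ^ 2)) ω
        ≤ ENNReal.ofReal (K * (1 + ‖x t ω‖ ^ 2))) :
    ∀ᵐ ω ∂μ, ∃ xstar : ι → ℝ,
      Function.IsFixedPt (Hstar ω) xstar ∧
      (∀ y, Function.IsFixedPt (Hstar ω) y → y = xstar) ∧
      Tendsto (fun t => x t ω) atTop (𝓝 xstar) := by
  have hxn : ∀ t, Measurable[ℱ t] fun ω => ‖x t ω‖ := fun t => measurable_norm.comp (hx t)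
  set G : ℕ → Ω → ℝ := fun t ω => runningMax (fun s => ‖x s ω‖) t with hG
  have hGm : ∀ t, Measurable[ℱ t] (G t) := fun t =>
    measurable_runningMax (f := fun s ω => ‖x s ω‖) hxn t
  have hG1 : ∀ t ω, 1 ≤ G t ω := fun t ω => one_le_runningMax _ t
  have hxG : ∀ t ω, ‖x t ω‖ ≤ G t ω := fun t ω => le_runningMax (fun s => ‖x s ω‖) t
  -- `K` may be negative, while variances must be nonnegative.
  set v : ℕ → Ω → ℝ := fun t ω => |K| * (1 + ‖x t ω‖ ^ 2) with hv
  have hv0 : ∀ t ω, 0 ≤ v t ω := fun t ω => by positivity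
  have hnoise : ∀ᵐ ω ∂μ, ∀ i, ∃ c, Tendsto
      (fun n => ∑ t ∈ Finset.range n, α t ω i / G t ω * e t ω i) atTop (𝓝 c) := by
    rw [ae_all_iff]
    intro i
    refine ae_tendsto_sum_of_summable_variance (ℱ := ℱ) (a := fun t ω => α t ω i / G t ω)
      (e := fun t ω => e t ω i) (v := v)
      (fun t => ((measurable_pi_apply i).comp (hα t)).div (hGm t))
      (fun t => (measurable_pi_apply i).comp (he t))
      (fun t => (((hxn t).pow_const 2).const_add 1).const_mul |K|) hv0
      (fun t => he_int t i) (fun t => he_mean t i) (fun t => ?_) ?_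
    · filter_upwards [he_var t i] with ω hω
      refine hω.trans (ENNReal.ofReal_le_ofReal ?_)
      exact mul_le_mul_of_nonneg_right (le_abs_self K) (by positivity)
    · filter_upwards [hα_sq] with ω hω
      refine Summable.of_nonneg_of_le (fun t => mul_nonneg (sq_nonneg _) (hv0 t ω)) (fun t => ?_)
        ((hω i).mul_left (2 * |K|))
      have hpos : 0 < G t ω := zero_lt_one.trans_le (hG1 t ω)
      -- Starting the running maximum at no less than `1` absorbs the constant term.
      have h2 : 1 + ‖x t ω‖ ^ 2 ≤ 2 * G t ω ^ 2 := by
        have h3 := hG1 t ω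
        have h4 : ‖x t ω‖ ^ 2 ≤ G t ω ^ 2 := by
          gcongr
          exact hxG t ω
        nlinarith
      calc (α t ω i / G t ω) ^ 2 * v t ω
          ≤ (α t ω i / G t ω) ^ 2 * (|K| * (2 * G t ω ^ 2)) := by
            gcongr
            exact mul_le_mul_of_nonneg_left h2 (abs_nonneg K)
        _ = 2 * |K| * α t ω i ^ 2 := by
            field_simp
  filter_upwards [hnoise, hcontr, hlim, hα_nonneg, hα_sum, hα_sq] with ω hz hc hl h0 h1 h2
  have hcs : ContractingWith γ (Hstar ω) := contractingWith_of_tendsto hc hl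
  have hγ1 : (γ : ℝ) < 1 := by exact_mod_cast hcs.1
  refine ⟨hcs.fixedPoint, hcs.fixedPoint_isFixedPt, fun y hy => hcs.fixedPoint_unique hy, ?_⟩
  have hz' : ∀ i, ∃ c, Tendsto
      (fun n => ∑ t ∈ Finset.range n, α t ω i * (e t ω i / G t ω)) atTop (𝓝 c) := fun i => by
    simpa only [div_mul_eq_mul_div, mul_div_assoc] using hz i
  have hrec' : ∀ t i, x (t + 1) ω i = (1 - α t ω i) * x t ω i
      + α t ω i * (H t ω (x t ω) i + G t ω * (e t ω i / G t ω)) := fun t i => by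
    rw [hrec, mul_div_cancel₀ _ (zero_lt_one.trans_le (hG1 t ω)).ne']
  -- Used twice: `y = 0` gives linear growth for boundedness, and `y` the fixed point gives a
  -- perturbation tending to zero.
  have hdiff : ∀ t y i, |H t ω (x t ω) i - y i| ≤ γ * ‖x t ω - y‖ + ‖H t ω y - y‖ := by
    intro t y i
    calc |H t ω (x t ω) i - y i| ≤ ‖H t ω (x t ω) - y‖ := norm_le_pi_norm (H t ω (x t ω) - y) i
      _ ≤ ‖H t ω (x t ω) - H t ω y‖ + ‖H t ω y - y‖ := norm_sub_le_norm_sub_add_norm_sub _ _ _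
      _ ≤ γ * ‖x t ω - y‖ + ‖H t ω y - y‖ := by
        gcongr
        simpa only [dist_eq_norm] using (hc t).2.dist_le_mul (x t ω) y
  obtain ⟨C, hC⟩ := (hl 0).norm.bddAbove_range
  obtain ⟨B, hB⟩ := bounded_of_stochastic_iteration (x := fun t => x t ω) (a := fun t => α t ω)
    (z := fun t i => e t ω i / G t ω) (h := fun t => H t ω (x t ω)) (G := fun t => G t ω) (C := C)
    hγ1 γ.2 h0 h2 hz' (fun t => hxG t ω) (fun t => rfl) hrec' fun t i => by
      have h3 := hdiff t 0 i
      have h4 : ‖H t ω 0‖ ≤ C := hC ⟨t, rfl⟩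
      simp only [Pi.zero_apply, sub_zero] at h3
      linarith
  refine tendsto_of_stochastic_iteration (x := fun t => x t ω) (a := fun t => α t ω)
    (z := fun t i => e t ω i / G t ω) (h := fun t => H t ω (x t ω)) (G := fun t => G t ω)
    (r := fun t => ‖H t ω hcs.fixedPoint - hcs.fixedPoint‖)
    hγ1 γ.2 h0 h2 h1 hz' (fun t => hxG t ω) (monotone_runningMax _) hB hrec'
    (fun t i => hdiff t _ i) ?_
  have h5 := hl hcs.fixedPoint
  rw [hcs.fixedPoint_isFixedPt] at h5
  exact tendsto_iff_norm_sub_tendsto_zero.1 h5
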